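/- **Setting.** Let $n,p\ge 1$, let $G$ be a graph with vertex set $\{1,\dots,p\}$, Laplacian $L$ and connected components (groups) $\mathcal C_1,\dots,\mathcal C_k$ of sizes $T_j=|\mathcal C_j|$; put $T_{\max}=\max_j T_j$, $T_{\min}=\min_j T_j$, and let $\lambda_g$ be the $(k+1)$-th smallest eigenvalue of $L$ (with multiplicity; $\lambda_g:=0$ if $k=p$). For $\beta\in\mathbb R^p$ let $\beta^j$ be its subvector indexed by $\mathcal C_j$, $\|\beta\|_{2,1}=\sum_{j=1}^k\|\beta^j\|_2$ and $A(\beta)=\{j:\beta^j\ne 0\}$. Let $y=X\beta^*+\varepsilon$, where $X\in\mathbb R^{n\times p}$ is fixed, $\beta^*\in\mathbb R^p$, and $\varepsilon$ has i.i.d. $N(0,\sigma^2)$ entries, $\sigma\ge 0$. With $X_j$ the submatrix of the columns of $X$ in $\mathcal C_j$, and $\eta\in(0,1)$, put $$\Lambda(X;\eta)=\max_{1\le j\le k}\sqrt{\Big\|\tfrac1n X_j^\top X_j\Big\|_{\mathrm{op}}}\Big(1+\sqrt{\tfrac{4\log\eta^{-1}}{T_j}}\Big),\qquad B[\beta^*;\epsilon]=\{\beta: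 n^{-1/2}\|X(\beta-\beta^*)\|_2\le\epsilon\}.$$ For $t\ge0$, $\lambda>0$ let $$F_{t,\lambda}(\beta)=\frac1{2n}\|y-X\beta\|_2^2+\lambda\sum_{i=1}^p\sqrt{\big|\big(e^{-tL}(\beta\odot\beta)\big)_i\big|},$$ where $\odot$ is the entrywise product. For $\gamma\ge0$, $s\in\mathbb N$, $\kappa>0$, a matrix $M$ with $p$ columns satisfies $\mathrm{RE}_\gamma(s,\kappa)$ if $\|M\Delta\|_2/\|\Delta_A\|_2\ge\kappa$ for all $A\subseteq\{1,\dots,k\}$ with $|A|\le s$ and all $\Delta\in\mathbb R^p\setminus\{0\}$ with $\sum_{j\notin A}\sqrt{T_j}\|\Delta^j\|_2\le\gamma\sum_{j\in A}\sqrt{T_j}\|\Delta^j\|_2$; here $\Delta_A$ is the subvector of $\Delta$ indexed by $\bigcup_{j\in A}\mathcal C_j$. **Theorem 1 (Estimation and prediction error).** There are an absolute constant $K_0>0$ and constants $K_\varpi>0$, depending only on $\varpi>0$, such that in the above setting the following holds. Let $\eta\in(0,1)$, $t\ge0$, $\lambda>0$, $\lambda\ge\frac{2\sigma}{\sqrt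 n}\Lambda(X;\eta)$ and $0<\epsilon\le\epsilon_0$. Let $C$ be a number such that - either $C\ge\|\beta\odot\beta\|_2^{1/2}$ for all $\beta\in B[\beta^*;\epsilon_0]$, - or $C\ge\sqrt{T_{\max}}\,\|\beta^*\|_{2,1}$, in which case $t$ is assumed to be so large that $p\,e^{-t\lambda_g/2}\le\frac14$. Then there is an event of probability at least $1-2k\eta$ on which every minimiser $\hat\beta$ of $F_{t,\lambda}$ over $B[\beta^*;\epsilon]$ satisfies (a) and (b): - (a) (Prediction error) If $8\sqrt{T_{\max}}\,\lambda\|\beta^*\|_{2,1}\le\epsilon$, then $$\tfrac1n\|X(\hat\beta-\beta^*)\|_2^2\le K_0\big(\|\beta^*\|_{2,1}\lambda\sqrt{T_{\max}}+\lambda C\,p\,e^{-t\lambda_g/2}\big).$$ If moreover $X/\sqrt n$ satisfies $\mathrm{RE}_{3+\varpi}(s,\kappa)$ for some $\varpi>0$, $\kappa>0$ and $s\ge|A(\beta^*)|$, then $$\tfrac1n\|X(\hat\beta-\beta^*)\|_2^2\le K_\varpi\Big(\frac{s\lambda^2T_{\max}}{\kappa^2}+\lambda C\,p\,e^{-t\lambda_g/2}\Big).$$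 - (b) (Estimation error) If $X/\sqrt n$ satisfies $\mathrm{RE}_{3+\varpi}(s,\kappa)$ for some $\varpi>0$, $\kappa>0$ and $s\ge|A(\beta^*)|$, then $$\|\hat\beta-\beta^*\|_{2,1}\le K_\varpi\Big(\frac{\lambda sT_{\max}}{\kappa^2\sqrt{T_{\min}}}+\frac{C\,p\,e^{-t\lambda_g/2}}{\sqrt{T_{\min}}}\Big).$$ -/

import Mathlib

open MeasureTheory ProbabilityTheory

namespace HeatFlow

noncomputable section

/-! ### Euclidean norms of vectors and subvectors -/

/-- The Euclidean norm of a real vector indexed by a finite type. -/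
def norm2 {ι : Type*} [Fintype ι] (v : ι → ℝ) : ℝ := ‖WithLp.toLp 2 v‖

/-- The Euclidean norm of the subvector of `v` with coordinates in `S`. -/
def subNorm {ι : Type*} (S : Finset ι) (v : ι → ℝ) : ℝ := norm2 (fun i : S => v i)

/-! ### The groups of variables: connected components of a graph on the variables -/

section Graph

variable {n p : ℕ} (G : SimpleGraph (Fin p)) [DecidableRel G.Adj]

/-- The number `k` of connected components (groups). -/
def numGroups : ℕ := Fintype.card G.ConnectedComponent

open Classical in
/-- The set of indices of the variables in the group `c`. -/
def groupSet (c : G.ConnectedComponent) : Finset (Fin p) := {i | G.connectedComponentMk i = c}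

/-- The size `T_c` of the group `c`. -/
def groupSize (c : G.ConnectedComponent) : ℕ := (groupSet G c).card

/-- The largest group size. -/
def maxGroupSize : ℕ := ⨆ c : G.ConnectedComponent, groupSize G c

/-- The smallest group size. -/
def minGroupSize : ℕ := ⨅ c : G.ConnectedComponent, groupSize G c

/-- The Euclidean norm `‖β^c‖` of the subvector of `β` in the group `c`. -/
def groupNorm (c : G.ConnectedComponent) (β : Fin p → ℝ) : ℝ := subNorm (groupSet G c) β

/-- The norm `‖β‖_{2,1}`: the sum of the Euclidean norms over the groups. -/
def norm21 (β : Fin p → ℝ) : ℝ := ∑ c : G.ConnectedComponent, groupNorm G c β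

open Classical in
/-- The set of active groups of `β`. -/
def activeGroups (β : Fin p → ℝ) : Finset G.ConnectedComponent := {c | groupNorm G c β ≠ 0}

/-! ### Laplacian, spectral gap, heat-flow penalty -/

lemma isHermitian_lap : (G.lapMatrix ℝ).IsHermitian := G.isHermitian_lapMatrix ℝ

/-- The spectral gap: the `(k+1)`-th smallest eigenvalue, with multiplicity, of the Laplacian, where
`k` is the number of connected components. (`eigenvalues₀` lists the eigenvalues in decreasing
order.) If `k = p`, i.e. if `G` has no edge, there is no such eigenvalue and the value is `0`. -/
def spectralGap : ℝ :=
  if h : numGroups G < p then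
    (isHermitian_lap G).eigenvalues₀ ⟨p - (numGroups G + 1), by simp only [Fintype.card_fin]; omega⟩
  else 0

/-- The heat flow `exp (-t L) f` at time `t` started from `f`. -/
def heatFlow (t : ℝ) (f : Fin p → ℝ) : Fin p → ℝ :=
  (NormedSpace.exp (-t • G.lapMatrix ℝ)).mulVec f

/-- The heat-flow penalty `∑ i, √|(exp (-t L) (β ⊙ β)) i|`. -/
def penalty (t : ℝ) (β : Fin p → ℝ) : ℝ := ∑ i, √|heatFlow G t (β * β) i|

/-- The penalised least squares objective. -/
def objective (X : Matrix (Fin n) (Fin p) ℝ) (y : Fin n → ℝ) (t lam : ℝ) (β : Fin p → ℝ) : ℝ :=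
  1 / (2 * n) * norm2 (y - X.mulVec β) ^ 2 + lam * penalty G t β

/-! ### Quantities attached to the design matrix -/

/-- The submatrix of `X` formed by the columns in the group `c`. -/
def groupCols (X : Matrix (Fin n) (Fin p) ℝ) (c : G.ConnectedComponent) :
    Matrix (Fin n) (groupSet G c) ℝ :=
  X.submatrix id Subtype.val

/-- The operator norm (for Euclidean norms) of `X_cᵀ X_c / n`. -/
def gramOpNorm (X : Matrix (Fin n) (Fin p) ℝ) (c : G.ConnectedComponent) : ℝ :=
  ‖Matrix.toEuclideanCLM (𝕜 := ℝ) ((1 / (n : ℝ)) • ((groupCols G X c).transpose * groupCols G X c))‖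

/-- The maximum over the groups of `√‖X_cᵀ X_c / n‖ * (1 + √(4 log (1/η) / T_c))`. -/
def noiseLevel (X : Matrix (Fin n) (Fin p) ℝ) (η : ℝ) : ℝ :=
  ⨆ c : G.ConnectedComponent,
    √(gramOpNorm G X c) * (1 + √(4 * Real.log η⁻¹ / groupSize G c))

open Classical in
/-- The group restricted eigenvalue property `RE_γ(s, κ)` of a matrix `M`. -/
def RestrictedEigenvalue (M : Matrix (Fin n) (Fin p) ℝ) (γ : ℝ) (s : ℕ) (κ : ℝ) : Prop :=
  ∀ (A : Finset G.ConnectedComponent) (Δ : Fin p → ℝ), A.card ≤ s → Δ ≠ 0 →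
    ∑ c ∈ Aᶜ, √(groupSize G c : ℝ) * groupNorm G c Δ ≤
      γ * ∑ c ∈ A, √(groupSize G c : ℝ) * groupNorm G c Δ →
    κ ≤ norm2 (M.mulVec Δ) / subNorm (A.biUnion (groupSet G)) Δ

end Graph

/-- The prediction error `‖X (β - β')‖² / n`. -/
def predError {n p : ℕ} (X : Matrix (Fin n) (Fin p) ℝ) (β β' : Fin p → ℝ) : ℝ :=
  1 / n * norm2 (X.mulVec (β - β')) ^ 2

/-- The prediction ball of radius `ε` around `β₀`. -/
def predBall {n p : ℕ} (X : Matrix (Fin n) (Fin p) ℝ) (β₀ : Fin p → ℝ) (ε : ℝ) :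
    Set (Fin p → ℝ) :=
  {β | 1 / √(n : ℝ) * norm2 (X.mulVec (β - β₀)) ≤ ε}

/-- `b` is a minimiser of the objective over the prediction ball of radius `ε` around `β₀`. -/
def IsEstimator {n p : ℕ} (G : SimpleGraph (Fin p)) [DecidableRel G.Adj]
    (X : Matrix (Fin n) (Fin p) ℝ) (y : Fin n → ℝ) (t lam : ℝ) (β₀ : Fin p → ℝ) (ε : ℝ)
    (b : Fin p → ℝ) : Prop :=
  b ∈ predBall X β₀ ε ∧ IsMinOn (objective G X y t lam) (predBall X β₀ ε) b

end

end HeatFlow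

namespace HeatFlow

/-! ### A chi-square type deviation bound -/

/-! The heat-flow penalty is a perturbed group lasso penalty. As `t → ∞`, `exp (-t L)` tends to the
averaging over groups, and the sum of square roots of the averages of `β ⊙ β` is exactly `∑ √T_c
‖β^c‖` (`groupPenalty`). Since the square root is 1/2-Hölder, the distance is at most `δ ‖β ⊙
β‖^{1/2}` with `δ = p exp (-t λ_g / 2)` (`abs_penalty_sub_groupPenalty_le`).

The rest is the group lasso argument with an additive error. A Gaussian tail bound and a union bound
give an event on which `λ / 2` times the penalty dominates the noise (`exists_noise_event`).
Comparing the objective at the estimator `b` and at the truth `βs` yields, with `R = groupPenalty`,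
`D ≤ λ R(b - βs) + 2λ (R(βs) - R(b)) + 16 λ M δ` for the prediction error `D`
(`predError_le_of_isEstimator`). The triangle inequality turns this into the slow rate. For the fast
rate and the estimation error, either the additive error is negligible and `b - βs` lies in the
restricted eigenvalue cone, or it dominates and bounds everything by itself
(`errors_le_of_restrictedEigenvalue`). -/

lemma lintegral_pi_prod {ι : Type*} [Fintype ι] {α : ι → Type*} [∀ i, MeasurableSpace (α i)]
    (ν : ∀ i, Measure (α i)) [∀ i, IsProbabilityMeasure (ν i)] {f : ∀ i, α i → ENNReal}
    (hf : ∀ i, Measurable (f i)) :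
    ∫⁻ x, ∏ i, f i (x i) ∂Measure.pi ν = ∏ i, ∫⁻ x, f i x ∂ν i := by
  have h := lintegral_prod_eq_prod_lintegral_of_indepFun (μ := Measure.pi ν) Finset.univ
    (fun i x => f i (x i)) (iIndepFun_pi (fun i => (hf i).aemeasurable))
    (fun i => (hf i).comp (measurable_pi_apply i))
  rw [h]
  exact Finset.prod_congr rfl fun i _ => (measurePreserving_eval ν i).lintegral_comp (hf i)

lemma lintegral_exp_mul_gaussianReal (v : NNReal) (a : ℝ) :
    ∫⁻ x, ENNReal.ofReal (Real.exp (a * x)) ∂gaussianReal 0 v =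
      ENNReal.ofReal (Real.exp (v * a ^ 2 / 2)) := by
  rw [← ofReal_integral_eq_lintegral_ofReal (integrable_exp_mul_gaussianReal a)
    (ae_of_all _ fun _ => (Real.exp_pos _).le)]
  have h := congrFun (mgf_id_gaussianReal (μ := 0) (v := v)) a
  simp only [mgf, id, zero_mul, zero_add] at h
  rw [h]

lemma lintegral_exp_dotProduct_pi_gaussianReal {ι : Type*} [Fintype ι] (v : NNReal) (a : ι → ℝ) :
    ∫⁻ x, ENNReal.ofReal (Real.exp (∑ i, a i * x i)) ∂Measure.pi (fun _ : ι => gaussianReal 0 v) =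
      ENNReal.ofReal (Real.exp (v / 2 * ∑ i, a i ^ 2)) := by
  simp only [Real.exp_sum, Finset.mul_sum]
  simp only [ENNReal.ofReal_prod_of_nonneg fun i _ => (Real.exp_pos _).le]
  rw [lintegral_pi_prod (fun _ : ι => gaussianReal 0 v)
    (f := fun i x => ENNReal.ofReal (Real.exp (a i * x))) (fun i => by fun_prop)]
  simp only [lintegral_exp_mul_gaussianReal]
  exact Finset.prod_congr rfl fun i _ => by ring_nf

lemma lintegral_exp_mul_sq_gaussianReal {c : ℝ} (hc : 2 * c < 1) :
    ∫⁻ x, ENNReal.ofReal (Real.exp (c * x ^ 2)) ∂gaussianReal 0 1 =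
      ENNReal.ofReal (√((1 - 2 * c)⁻¹)) := by
  rw [gaussianReal_of_var_ne_zero _ one_ne_zero,
    lintegral_withDensity_eq_lintegral_mul _ (measurable_gaussianPDF 0 1) (by fun_prop)]
  have h1 : ∀ x : ℝ, (gaussianPDF 0 1 * fun x => ENNReal.ofReal (Real.exp (c * x ^ 2))) x =
      ENNReal.ofReal ((√(2 * Real.pi))⁻¹ * Real.exp (-(1 / 2 - c) * x ^ 2)) := by
    intro x
    rw [Pi.mul_apply, gaussianPDF, ← ENNReal.ofReal_mul (gaussianPDFReal_nonneg _ _ _),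
      gaussianPDFReal_def]
    simp only [NNReal.coe_one, mul_one, sub_zero]
    rw [mul_assoc, ← Real.exp_add]
    ring_nf
  simp only [h1]
  rw [← ofReal_integral_eq_lintegral_ofReal
    ((integrable_exp_neg_mul_sq (by linarith)).const_mul _)
    (ae_of_all _ fun _ => by positivity), integral_const_mul, integral_gaussian,
    ← Real.sqrt_inv, ← Real.sqrt_mul (by positivity)]
  congr 2
  have : 1 - 2 * c ≠ 0 := by linarith
  have : 1 / 2 - c ≠ 0 := by intro h; apply this; linarith
  field_simp

lemma lintegral_exp_sum_sq_pi_gaussianReal {ι : Type*} [Fintype ι] {c : ℝ} (hc : 2 * c < 1) :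
    ∫⁻ x, ENNReal.ofReal (Real.exp (c * ∑ i, x i ^ 2)) ∂Measure.pi (fun _ : ι => gaussianReal 0 1) =
      ENNReal.ofReal (√((1 - 2 * c)⁻¹)) ^ Fintype.card ι := by
  simp only [Finset.mul_sum, Real.exp_sum]
  simp only [ENNReal.ofReal_prod_of_nonneg fun i _ => (Real.exp_pos _).le]
  rw [lintegral_pi_prod (fun _ : ι => gaussianReal 0 1)
    (f := fun _ x => ENNReal.ofReal (Real.exp (c * x ^ 2))) (fun i => by fun_prop)]
  simp [lintegral_exp_mul_sq_gaussianReal hc]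

/-- The exponential moment of the squared norm of a Gaussian vector, by Gaussian decoupling. -/
lemma lintegral_exp_sq_transpose_mulVec_le {ι τ : Type*} [Fintype ι] [Fintype τ] (v : NNReal)
    (A : Matrix ι τ ℝ) {q s : ℝ} (hA : ∀ h : τ → ℝ, ∑ i, A.mulVec h i ^ 2 ≤ q * ∑ j, h j ^ 2)
    (hs : 0 ≤ s) (hsq : 2 * (s * v * q) < 1) :
    ∫⁻ x, ENNReal.ofReal (Real.exp (s * ∑ j, A.transpose.mulVec x j ^ 2))
        ∂Measure.pi (fun _ : ι => gaussianReal 0 v) ≤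
      ENNReal.ofReal (√((1 - 2 * (s * v * q))⁻¹)) ^ Fintype.card τ := by
  -- Linearise the square: `exp (s ‖Aᵀx‖²)` is the moment generating function of a standard Gaussian
  -- `h` at `√(2s) Aᵀx`. Integrating over `x` first then leaves `exp (s v ‖A h‖²)`, which `hA`
  -- controls.
  have h1 : ∀ x : ι → ℝ, ENNReal.ofReal (Real.exp (s * ∑ j, A.transpose.mulVec x j ^ 2)) =
      ∫⁻ h, ENNReal.ofReal (Real.exp (∑ j, (√(2 * s) * A.transpose.mulVec x j) * h j))
        ∂Measure.pi (fun _ : τ => gaussianReal 0 1) := by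
    intro x
    rw [lintegral_exp_dotProduct_pi_gaussianReal]
    simp only [mul_pow, Real.sq_sqrt (show 0 ≤ 2 * s by positivity), ← Finset.mul_sum]
    congr 2
    push_cast
    ring
  simp only [h1]
  rw [lintegral_lintegral_swap]
  · rw [← lintegral_exp_sum_sq_pi_gaussianReal hsq]
    refine lintegral_mono fun h => ?_
    have h2 : ∀ x : ι → ℝ, ∑ j, (√(2 * s) * A.transpose.mulVec x j) * h j =
        ∑ i, (√(2 * s) * A.mulVec h i) * x i := by
      intro x
      simp only [Matrix.mulVec, dotProduct, Finset.mul_sum, Finset.sum_mul, Matrix.transpose_apply]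
      rw [Finset.sum_comm]
      exact Finset.sum_congr rfl fun i _ => Finset.sum_congr rfl fun j _ => by ring
    simp only [h2]
    rw [lintegral_exp_dotProduct_pi_gaussianReal]
    refine ENNReal.ofReal_le_ofReal (Real.exp_le_exp.2 ?_)
    simp only [mul_pow, Real.sq_sqrt (show 0 ≤ 2 * s by positivity), ← Finset.mul_sum]
    have := mul_le_mul_of_nonneg_left (hA h) (show 0 ≤ s * v by positivity)
    linarith
  · refine Measurable.aemeasurable ?_
    refine ENNReal.measurable_ofReal.comp (Real.measurable_exp.comp ?_)
    simp only [Matrix.mulVec, dotProduct]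
    fun_prop

/-- Chernoff bound for the norm of a Gaussian vector. -/
lemma pi_gaussianReal_sq_transpose_mulVec_gt_le {ι τ : Type*} [Fintype ι] [Fintype τ] [Nonempty τ]
    (v : NNReal) (A : Matrix ι τ ℝ) {q r : ℝ} (hq : 0 ≤ q) (hr : 0 ≤ r)
    (hA : ∀ h : τ → ℝ, ∑ i, A.mulVec h i ^ 2 ≤ q * ∑ j, h j ^ 2) :
    Measure.pi (fun _ : ι => gaussianReal 0 v)
        {x | v * q * (√(Fintype.card τ : ℝ) + r) ^ 2 < ∑ j, A.transpose.mulVec x j ^ 2} ≤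
      ENNReal.ofReal (Real.exp (-r ^ 2 / 2)) := by
  set P := Measure.pi (fun _ : ι => gaussianReal 0 v)
  have hmeas : Measurable fun x : ι → ℝ => ∑ j, A.transpose.mulVec x j ^ 2 := by
    simp only [Matrix.mulVec, dotProduct]
    fun_prop
  set T : ℝ := (Fintype.card τ : ℝ) with hT
  have hT0 : 0 < T := by rw [hT]; exact_mod_cast Fintype.card_pos
  rcases (mul_nonneg v.2 hq).eq_or_lt with h0 | h0
  -- Degenerate case, where the Chernoff parameter below would divide by zero: `exp ‖Aᵀx‖² ≥ 1` has
  -- integral at most `1`, so `Aᵀx = 0` almost surely.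
  · have hvq : (v : ℝ) * q = 0 := h0.symm
    have h1 := lintegral_exp_sq_transpose_mulVec_le v A hA zero_le_one (by simp [hvq])
    simp only [one_mul, hvq, mul_zero, sub_zero, inv_one, Real.sqrt_one, ENNReal.ofReal_one,
      one_pow] at h1
    have h2 : (fun _ => 1) =ᵐ[P]
        fun x => ENNReal.ofReal (Real.exp (∑ j, A.transpose.mulVec x j ^ 2)) := by
      refine ae_eq_of_ae_le_of_lintegral_le (ae_of_all _ fun x => ?_) (by simp)
        (by fun_prop) (by simpa using h1)
      rw [ENNReal.one_le_ofReal]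
      exact Real.one_le_exp (Finset.sum_nonneg fun _ _ => sq_nonneg _)
    have h3 : P {x | v * q * (√T + r) ^ 2 < ∑ j, A.transpose.mulVec x j ^ 2} = 0 := by
      rw [measure_eq_zero_iff_ae_notMem]
      filter_upwards [h2] with x hx
      simp only [hvq, zero_mul, not_lt]
      have := ENNReal.ofReal_le_one.1 hx.ge
      simpa using this
    rw [h3]
    exact zero_le
  · set ρ := r / √T with hρ
    have hρ0 : 0 ≤ ρ := by positivity
    have hsT : 0 < √T := Real.sqrt_pos.2 hT0
    have hrρ : r = ρ * √T := by rw [hρ]; field_simp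
    set u : ℝ := (1 + ρ) ^ 2 with hu
    have hu1 : 1 ≤ u := by rw [hu]; nlinarith
    -- The threshold is `v q u T`, and this `s` minimises the Chernoff bound: it makes `1 - 2 s v q
    -- = u⁻¹`, so the moment bound becomes `(1 + ρ) ^ T`.
    set s : ℝ := (1 - u⁻¹) / (2 * (v * q)) with hs
    have hui : u⁻¹ ≤ 1 := inv_le_one_of_one_le₀ hu1
    have hs0 : 0 ≤ s := div_nonneg (by linarith) (by positivity)
    have hsq : 1 - 2 * (s * v * q) = u⁻¹ := by
      have : s * (v * q) = (1 - u⁻¹) / 2 := by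
        rw [hs, div_mul_eq_mul_div, div_eq_div_iff (by positivity) two_ne_zero]
        ring
      linarith
    have hupos : 0 < u⁻¹ := by positivity
    have h1 := lintegral_exp_sq_transpose_mulVec_le v A hA hs0 (by linarith)
    rw [hsq, inv_inv, hu, Real.sqrt_sq (by linarith)] at h1
    set a : ℝ := v * q * (√T + r) ^ 2
    have hsa : s * a = (u - 1) * T / 2 := by
      have e1 : a = v * q * (u * T) := by
        simp only [a]
        rw [hrρ, hu]
        have := Real.sq_sqrt hT0.le
        linear_combination (v * q * (1 + ρ) ^ 2) * this
      rw [e1]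
      have : s * (v * q) = (1 - u⁻¹) / 2 := by linarith
      calc s * (v * q * (u * T)) = (s * (v * q)) * (u * T) := by ring
        _ = (u - 1) * T / 2 := by rw [this]; field_simp
    have h2 := mul_meas_ge_le_lintegral₀ (μ := P)
      (f := fun x => ENNReal.ofReal (Real.exp (s * ∑ j, A.transpose.mulVec x j ^ 2)))
      (by fun_prop) (ENNReal.ofReal (Real.exp (s * a)))
    have h3 : P {x | a < ∑ j, A.transpose.mulVec x j ^ 2} ≤
        P {x | ENNReal.ofReal (Real.exp (s * a)) ≤
          ENNReal.ofReal (Real.exp (s * ∑ j, A.transpose.mulVec x j ^ 2))} := by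
      refine measure_mono fun x hx => ?_
      exact ENNReal.ofReal_le_ofReal (Real.exp_le_exp.2 (mul_le_mul_of_nonneg_left (le_of_lt hx) hs0))
    -- By `1 + ρ ≤ exp ρ`, what remains is the exponent `T ρ - T ((1 + ρ)² - 1) / 2 = -r² / 2`.
    have h4 : (1 + ρ) ^ Fintype.card τ ≤ Real.exp (s * a) * Real.exp (-r ^ 2 / 2) := by
      calc (1 + ρ) ^ Fintype.card τ ≤ Real.exp ρ ^ Fintype.card τ :=
            pow_le_pow_left₀ (by linarith) (by linarith [Real.add_one_le_exp ρ]) _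
        _ = Real.exp (T * ρ) := by rw [← Real.exp_nat_mul]
        _ = _ := by
          rw [← Real.exp_add, hsa, hrρ, mul_pow, Real.sq_sqrt hT0.le, hu]
          congr 1
          ring
    have hpos : ENNReal.ofReal (Real.exp (s * a)) ≠ 0 := by
      simp [Real.exp_pos]
    refine h3.trans ?_
    rw [← ENNReal.mul_le_mul_iff_right hpos ENNReal.ofReal_ne_top,
      ← ENNReal.ofReal_mul (Real.exp_pos _).le]
    refine h2.trans (h1.trans ?_)
    rw [← ENNReal.ofReal_pow (by linarith)]
    exact ENNReal.ofReal_le_ofReal h4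

/-! ### Euclidean norms -/

lemma norm2_nonneg {ι : Type*} [Fintype ι] (v : ι → ℝ) : 0 ≤ norm2 v := norm_nonneg _

lemma norm2_sq {ι : Type*} [Fintype ι] (v : ι → ℝ) : norm2 v ^ 2 = ∑ i, v i ^ 2 := by
  simp [norm2, EuclideanSpace.norm_sq_eq]

lemma abs_le_norm2 {ι : Type*} [Fintype ι] (v : ι → ℝ) (i : ι) : |v i| ≤ norm2 v :=
  PiLp.norm_apply_le (WithLp.toLp 2 v) i

lemma dotProduct_le_norm2_mul_norm2 {ι : Type*} [Fintype ι] (v w : ι → ℝ) :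
    v ⬝ᵥ w ≤ norm2 v * norm2 w := by
  have h := real_inner_le_norm (WithLp.toLp 2 w) (WithLp.toLp 2 v)
  rw [mul_comm] at h
  simpa [norm2, EuclideanSpace.inner_eq_star_dotProduct] using h

lemma subNorm_nonneg {ι : Type*} (S : Finset ι) (v : ι → ℝ) : 0 ≤ subNorm S v := norm2_nonneg _

lemma subNorm_sq {ι : Type*} (S : Finset ι) (v : ι → ℝ) : subNorm S v ^ 2 = ∑ i ∈ S, v i ^ 2 := by
  rw [subNorm, norm2_sq, Finset.sum_coe_sort S (fun i => v i ^ 2)]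

lemma subNorm_add_le {ι : Type*} (S : Finset ι) (v w : ι → ℝ) :
    subNorm S (v + w) ≤ subNorm S v + subNorm S w :=
  norm_add_le (WithLp.toLp 2 fun i : S => v i) (WithLp.toLp 2 fun i : S => w i)

lemma subNorm_sub_comm {ι : Type*} (S : Finset ι) (v w : ι → ℝ) :
    subNorm S (v - w) = subNorm S (w - v) :=
  norm_sub_rev (WithLp.toLp 2 fun i : S => v i) (WithLp.toLp 2 fun i : S => w i)

lemma sum_mul_le_subNorm_mul_subNorm {ι : Type*} (S : Finset ι) (v w : ι → ℝ) :
    ∑ i ∈ S, v i * w i ≤ subNorm S v * subNorm S w := by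
  rw [← Finset.sum_coe_sort S (fun i => v i * w i)]
  exact dotProduct_le_norm2_mul_norm2 (fun i : S => v i) (fun i : S => w i)

/-! ### Groups -/

section Graph

variable {p : ℕ} (G : SimpleGraph (Fin p))

lemma mem_groupSet {c : G.ConnectedComponent} {i : Fin p} :
    i ∈ groupSet G c ↔ G.connectedComponentMk i = c := by
  simp [groupSet]

lemma groupSize_pos (c : G.ConnectedComponent) : 0 < groupSize G c := by
  induction c using SimpleGraph.ConnectedComponent.ind with
  | _ i => exact Finset.card_pos.2 ⟨i, (mem_groupSet G).2 rfl⟩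

lemma groupSize_le_maxGroupSize (c : G.ConnectedComponent) : groupSize G c ≤ maxGroupSize G :=
  le_ciSup (f := fun c => groupSize G c) (Set.finite_range _).bddAbove c

lemma minGroupSize_le_groupSize (c : G.ConnectedComponent) : minGroupSize G ≤ groupSize G c :=
  ciInf_le (f := fun c => groupSize G c) (Set.finite_range _).bddBelow c

lemma minGroupSize_pos [Nonempty G.ConnectedComponent] : 0 < minGroupSize G := by
  obtain ⟨c, hc⟩ := ciInf_mem fun c : G.ConnectedComponent => groupSize G c
  rw [minGroupSize, ← hc]
  exact groupSize_pos G c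

lemma groupNorm_nonneg (c : G.ConnectedComponent) (β : Fin p → ℝ) : 0 ≤ groupNorm G c β :=
  subNorm_nonneg _ _

lemma groupNorm_sq (c : G.ConnectedComponent) (β : Fin p → ℝ) :
    groupNorm G c β ^ 2 = ∑ i ∈ groupSet G c, β i ^ 2 := subNorm_sq _ _

lemma sum_groupNorm_sq (A : Finset G.ConnectedComponent) (β : Fin p → ℝ) [DecidableEq (Fin p)] :
    ∑ c ∈ A, groupNorm G c β ^ 2 = subNorm (A.biUnion (groupSet G)) β ^ 2 := by
  rw [subNorm_sq, Finset.sum_biUnion]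
  · exact Finset.sum_congr rfl fun c _ => groupNorm_sq G c β
  · intro c _ d _ hcd
    refine Finset.disjoint_left.2 fun i hi hj => hcd ?_
    rw [← (mem_groupSet G).1 hi, (mem_groupSet G).1 hj]

variable [DecidableRel G.Adj]

lemma sum_sum_groupSet (f : Fin p → ℝ) : ∑ c, ∑ i ∈ groupSet G c, f i = ∑ i, f i := by
  classical
  rw [← Finset.sum_fiberwise Finset.univ (fun i => G.connectedComponentMk i) f]
  refine Finset.sum_congr rfl fun c _ => Finset.sum_congr ?_ fun _ _ => rfl
  ext i
  simp [mem_groupSet]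

/-- The limit of the heat-flow penalty: the group lasso penalty `∑ √T_c ‖β^c‖`. -/
noncomputable def groupPenalty (β : Fin p → ℝ) : ℝ :=
  ∑ c : G.ConnectedComponent, √(groupSize G c : ℝ) * groupNorm G c β

lemma norm21_nonneg (β : Fin p → ℝ) : 0 ≤ norm21 G β :=
  Finset.sum_nonneg fun c _ => groupNorm_nonneg G c β

lemma norm21_le_groupPenalty (β : Fin p → ℝ) : norm21 G β ≤ groupPenalty G β := by
  refine Finset.sum_le_sum fun c _ => le_mul_of_one_le_left (groupNorm_nonneg G c β) ?_
  rw [Real.one_le_sqrt]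
  exact_mod_cast groupSize_pos G c

lemma groupPenalty_le (β : Fin p → ℝ) :
    groupPenalty G β ≤ √(maxGroupSize G : ℝ) * norm21 G β := by
  rw [norm21, Finset.mul_sum]
  refine Finset.sum_le_sum fun c _ => mul_le_mul_of_nonneg_right (Real.sqrt_le_sqrt ?_)
    (groupNorm_nonneg G c β)
  exact_mod_cast groupSize_le_maxGroupSize G c

lemma sqrt_minGroupSize_mul_norm21_le (β : Fin p → ℝ) :
    √(minGroupSize G : ℝ) * norm21 G β ≤ groupPenalty G β := by
  rw [norm21, Finset.mul_sum]
  refine Finset.sum_le_sum fun c _ => mul_le_mul_of_nonneg_right (Real.sqrt_le_sqrt ?_)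
    (groupNorm_nonneg G c β)
  exact_mod_cast minGroupSize_le_groupSize G c

/-- `‖β ⊙ β‖^{1/2} = ‖β‖₄ ≤ ‖β‖_{2,1}`. -/
lemma sqrt_norm2_mul_self_le_norm21 (β : Fin p → ℝ) : √(norm2 (β * β)) ≤ norm21 G β := by
  have h0 := norm21_nonneg G β
  have h1 : ∑ i, β i ^ 2 ≤ norm21 G β ^ 2 := by
    rw [← sum_sum_groupSet G, norm21]
    simp only [← groupNorm_sq]
    exact Finset.sum_sq_le_sq_sum_of_nonneg fun c _ => groupNorm_nonneg G c β
  have h2 : norm2 (β * β) ≤ ∑ i, β i ^ 2 := by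
    refine le_of_sq_le_sq ?_ (Finset.sum_nonneg fun i _ => sq_nonneg _)
    rw [norm2_sq]
    refine le_trans (le_of_eq ?_) (Finset.sum_sq_le_sq_sum_of_nonneg fun i _ => sq_nonneg (β i))
    exact Finset.sum_congr rfl fun i _ => by rw [Pi.mul_apply]; ring
  rw [Real.sqrt_le_left h0]
  exact h2.trans h1

/-! ### The heat flow converges to the group averages -/

/-- The projection onto the kernel of the Laplacian: averaging over the groups. -/
noncomputable def groupAverage (f : Fin p → ℝ) (i : Fin p) : ℝ :=
  (∑ j ∈ groupSet G (G.connectedComponentMk i), f j) /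
    groupSize G (G.connectedComponentMk i)

lemma lapMatrix_mulVec_groupAverage (f : Fin p → ℝ) :
    (G.lapMatrix ℝ).mulVec (groupAverage G f) = 0 := by
  rw [SimpleGraph.lapMatrix_mulVec_eq_zero_iff_forall_reachable]
  intro i j h
  rw [groupAverage, groupAverage, SimpleGraph.ConnectedComponent.sound h]

/-- A vector in the kernel is constant on each group, and deviations from a group average sum to
zero there. -/
lemma dotProduct_sub_groupAverage (f : Fin p → ℝ) {v : Fin p → ℝ}
    (hv : (G.lapMatrix ℝ).mulVec v = 0) : v ⬝ᵥ (f - groupAverage G f) = 0 := by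
  rw [SimpleGraph.lapMatrix_mulVec_eq_zero_iff_forall_reachable] at hv
  rw [dotProduct, ← sum_sum_groupSet G]
  refine Finset.sum_eq_zero fun c _ => ?_
  induction c using SimpleGraph.ConnectedComponent.ind with
  | _ k =>
    have h1 : ∀ i ∈ groupSet G (G.connectedComponentMk k), v i * (f - groupAverage G f) i =
        v k * (f i - (∑ j ∈ groupSet G (G.connectedComponentMk k), f j) /
          groupSize G (G.connectedComponentMk k)) := by
      intro i hi
      have hi' := (mem_groupSet G).1 hi
      rw [hv i k (SimpleGraph.ConnectedComponent.exact hi'), Pi.sub_apply, groupAverage, hi']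
    have h2 : (groupSize G (G.connectedComponentMk k) : ℝ) ≠ 0 := by
      exact_mod_cast (groupSize_pos G _).ne'
    rw [Finset.sum_congr rfl h1, ← Finset.mul_sum, Finset.sum_sub_distrib, Finset.sum_const,
      nsmul_eq_mul, ← groupSize, mul_div_cancel₀ _ h2, sub_self, mul_zero]

lemma exp_mulVec_of_mulVec_eq_smul {ι : Type*} [Fintype ι] [DecidableEq ι] (A : Matrix ι ι ℝ)
    {v : ι → ℝ} {a : ℝ} (h : A.mulVec v = a • v) :
    (NormedSpace.exp A).mulVec v = Real.exp a • v := by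
  -- An auxiliary norm on matrices, used only for the convergence of the exponential series.
  let _ : NormedRing (Matrix ι ι ℝ) := Matrix.linftyOpNormedRing
  let _ : NormedAlgebra ℝ (Matrix ι ι ℝ) := Matrix.linftyOpNormedAlgebra
  have h1 := NormedSpace.exp_series_hasSum_exp' (𝕂 := ℝ) A
  have h2 : HasSum (fun k : ℕ => ((k.factorial : ℝ)⁻¹ • A ^ k).mulVec v)
      ((NormedSpace.exp A).mulVec v) :=
    h1.map (Matrix.mulVecBilin ℝ ℝ |>.flip v : Matrix ι ι ℝ →ₗ[ℝ] ι → ℝ)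
      (continuous_id.matrix_mulVec continuous_const)
  have h3 : ∀ k : ℕ, (A ^ k).mulVec v = a ^ k • v := by
    intro k
    induction k with
    | zero => simp
    | succ k ih => rw [pow_succ, ← Matrix.mulVec_mulVec, h, Matrix.mulVec_smul, ih, smul_smul, pow_succ']
  have h4 := (NormedSpace.exp_series_hasSum_exp' (𝕂 := ℝ) a).smul_const v
  rw [← Real.exp_eq_exp_ℝ] at h4
  refine h2.unique ?_
  convert h4 using 2 with k
  rw [Matrix.smul_mulVec, h3, smul_smul, smul_eq_mul]

/-- The kernel has dimension `k`, so exactly `p - k` eigenvalues are nonzero. In decreasing order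
and counting from `0`, a nonzero eigenvalue below the one at position `p - k - 1` would sit further
on, with all its predecessors nonzero: too many. -/
lemma spectralGap_le_eigenvalues (i : Fin p) (hi : (isHermitian_lap G).eigenvalues i ≠ 0) :
    spectralGap G ≤ (isHermitian_lap G).eigenvalues i := by
  have hpos : ∀ j, 0 ≤ (isHermitian_lap G).eigenvalues j :=
    (SimpleGraph.posSemidef_lapMatrix ℝ G).eigenvalues_nonneg
  have hcard : Fintype.card {j // (isHermitian_lap G).eigenvalues j ≠ 0} + numGroups G = p := by
    rw [← Matrix.IsHermitian.rank_eq_card_non_zero_eigs, numGroups,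
      SimpleGraph.card_connectedComponent_eq_finrank_ker_toLin'_lapMatrix, Matrix.rank,
      Matrix.toLin'_apply', LinearMap.finrank_range_add_finrank_ker]
    simp
  rw [spectralGap]
  split_ifs with h
  · set e : Fin (Fintype.card (Fin p)) ≃ Fin p := Fintype.equivOfCardEq (Fintype.card_fin _)
    have he : ∀ j, (isHermitian_lap G).eigenvalues (e j) =
        (isHermitian_lap G).eigenvalues₀ j := fun j => by
      simp [Matrix.IsHermitian.eigenvalues, e]
    obtain ⟨j, rfl⟩ := e.surjective i
    by_contra hlt
    rw [not_le, he] at hlt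
    have hj : p - (numGroups G + 1) < j.1 := by
      by_contra hle
      exact absurd ((isHermitian_lap G).eigenvalues₀_antitone (Fin.le_def.2 (not_lt.1 hle)))
        (not_le.2 hlt)
    have hle : ∀ l : Fin (j.1 + 1), (isHermitian_lap G).eigenvalues
        (e (Fin.castLE (Nat.succ_le_of_lt j.2) l)) ≠ 0 := by
      intro l
      have h1 := (isHermitian_lap G).eigenvalues₀_antitone
        (show Fin.castLE (Nat.succ_le_of_lt j.2) l ≤ j from
          Fin.le_def.2 (Nat.lt_succ_iff.1 l.2))
      rw [← he, ← he] at h1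
      exact (lt_of_lt_of_le ((hpos _).lt_of_ne' hi) h1).ne'
    have hc := Fintype.card_le_of_injective
      (fun l : Fin (j.1 + 1) => (⟨_, hle l⟩ : {j // (isHermitian_lap G).eigenvalues j ≠ 0}))
      (fun a b hab => by simpa using hab)
    rw [Fintype.card_fin] at hc
    omega
  · exact hpos i

lemma heatFlow_eq_of_mulVec_eq_zero (t : ℝ) {v : Fin p → ℝ} (hv : (G.lapMatrix ℝ).mulVec v = 0) :
    heatFlow G t v = v := by
  rw [heatFlow, exp_mulVec_of_mulVec_eq_smul (a := 0)]
  · simp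
  · rw [Matrix.smul_mulVec, hv]; simp

/-- The flow fixes the group average, so only `u = f - groupAverage G f` evolves. In an eigenbasis
of the Laplacian, `u` has no component of eigenvalue `0`, and every other component decays at rate
at least the spectral gap. -/
lemma norm2_heatFlow_sub_groupAverage_le {t : ℝ} (ht : 0 ≤ t) (f : Fin p → ℝ) :
    norm2 (heatFlow G t f - groupAverage G f) ≤ Real.exp (-t * spectralGap G) * norm2 f := by
  set u := f - groupAverage G f with hu
  have h1 : heatFlow G t f - groupAverage G f = heatFlow G t u := by
    conv_lhs => rw [← heatFlow_eq_of_mulVec_eq_zero G t (lapMatrix_mulVec_groupAverage G f)]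
    rw [heatFlow, heatFlow, ← Matrix.mulVec_sub, ← hu, heatFlow]
  -- Pythagoras: `u` is orthogonal to the group average.
  have huf : norm2 u ≤ norm2 f := by
    refine le_of_sq_le_sq ?_ (norm2_nonneg f)
    have h2 := dotProduct_sub_groupAverage G f (lapMatrix_mulVec_groupAverage G f)
    rw [norm2_sq, norm2_sq, ← sub_nonneg, ← Finset.sum_sub_distrib]
    have h3 : ∑ i, (f i ^ 2 - u i ^ 2) =
        2 * (groupAverage G f ⬝ᵥ u) + ∑ i, groupAverage G f i ^ 2 := by
      rw [dotProduct, Finset.mul_sum, ← Finset.sum_add_distrib]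
      refine Finset.sum_congr rfl fun i _ => ?_
      rw [hu, Pi.sub_apply]
      ring
    rw [h3, h2, mul_zero, zero_add]
    exact Finset.sum_nonneg fun i _ => sq_nonneg _
  have hE : 0 ≤ Real.exp (-t * spectralGap G) := (Real.exp_pos _).le
  rw [h1]
  refine le_trans ?_ (mul_le_mul_of_nonneg_left huf hE)
  refine le_of_sq_le_sq ?_ (mul_nonneg hE (norm2_nonneg u))
  set b := (isHermitian_lap G).eigenvectorBasis
  have hsymm : (NormedSpace.exp (-t • G.lapMatrix ℝ)).transpose =
      NormedSpace.exp (-t • G.lapMatrix ℝ) := by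
    rw [← Matrix.exp_transpose, Matrix.transpose_smul, (G.isSymm_lapMatrix (R := ℝ)).eq]
  have hin : ∀ (i : Fin p) (w : Fin p → ℝ), inner ℝ (b i) (WithLp.toLp 2 w) = b i ⬝ᵥ w := by
    intro i w
    simp [EuclideanSpace.inner_eq_star_dotProduct, dotProduct_comm]
  have hb : ∀ i, inner ℝ (b i) (WithLp.toLp 2 (heatFlow G t u)) =
      Real.exp (-t * (isHermitian_lap G).eigenvalues i) * inner ℝ (b i) (WithLp.toLp 2 u) := by
    intro i
    rw [hin, hin, heatFlow, Matrix.dotProduct_mulVec, ← Matrix.mulVec_transpose, hsymm,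
      exp_mulVec_of_mulVec_eq_smul (a := -t * (isHermitian_lap G).eigenvalues i),
      smul_dotProduct, smul_eq_mul]
    rw [Matrix.smul_mulVec, (isHermitian_lap G).mulVec_eigenvectorBasis, smul_smul]
  rw [mul_pow, norm2, norm2, ← b.sum_sq_norm_inner_right, ← b.sum_sq_norm_inner_right,
    Finset.mul_sum]
  refine Finset.sum_le_sum fun i _ => ?_
  rw [hb, norm_mul, mul_pow]
  by_cases hi : (isHermitian_lap G).eigenvalues i = 0
  · have h4 : inner ℝ (b i) (WithLp.toLp 2 u) = 0 := by
      rw [hin, hu]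
      refine dotProduct_sub_groupAverage G f ?_
      rw [(isHermitian_lap G).mulVec_eigenvectorBasis, hi, zero_smul]
    simp [h4]
  · refine mul_le_mul_of_nonneg_right ?_ (sq_nonneg _)
    rw [Real.norm_of_nonneg (Real.exp_pos _).le]
    refine pow_le_pow_left₀ (Real.exp_pos _).le (Real.exp_le_exp.2 ?_) 2
    have := mul_le_mul_of_nonneg_left (spectralGap_le_eigenvalues G i hi) ht
    linarith

/-- The heat-flow penalty approximates the group lasso penalty. -/
lemma abs_penalty_sub_groupPenalty_le {t : ℝ} (ht : 0 ≤ t) (β : Fin p → ℝ) :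
    |penalty G t β - groupPenalty G β| ≤
      p * Real.exp (-t * spectralGap G / 2) * √(norm2 (β * β)) := by
  -- Each of the `T_c` coordinates of a group contributes `‖β^c‖ / √T_c`.
  have h1 : groupPenalty G β = ∑ i, √|groupAverage G (β * β) i| := by
    rw [groupPenalty, ← sum_sum_groupSet G]
    refine Finset.sum_congr rfl fun c _ => ?_
    have h2 : ∀ i ∈ groupSet G c, √|groupAverage G (β * β) i| =
        groupNorm G c β / √(groupSize G c : ℝ) := by
      intro i hi
      rw [groupAverage, (mem_groupSet G).1 hi]
      simp only [Pi.mul_apply, ← sq, ← groupNorm_sq]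
      rw [abs_of_nonneg (by positivity), Real.sqrt_div (sq_nonneg _),
        Real.sqrt_sq (groupNorm_nonneg G c β)]
    have h3 : 0 < (groupSize G c : ℝ) := by exact_mod_cast groupSize_pos G c
    rw [Finset.sum_congr rfl h2, Finset.sum_const, nsmul_eq_mul, ← groupSize]
    have := Real.sqrt_pos.2 h3
    have h4 := Real.sq_sqrt h3.le
    field_simp
    rw [h4, mul_comm]
  -- This Hölder bound is what halves the exponential rate.
  have hsub : ∀ a b : ℝ, abs (√|a| - √|b|) ≤ √|a - b| := by
    have key : ∀ a b : ℝ, √|a| ≤ √|b| + √|a - b| := by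
      intro a b
      rw [Real.sqrt_le_left (by positivity)]
      have := abs_add_le b (a - b)
      rw [add_sub_cancel] at this
      nlinarith [Real.sq_sqrt (abs_nonneg b), Real.sq_sqrt (abs_nonneg (a - b)),
        mul_nonneg (Real.sqrt_nonneg |b|) (Real.sqrt_nonneg |a - b|)]
    intro a b
    have h2 := key b a
    rw [abs_sub_comm b a] at h2
    exact abs_sub_le_iff.2 ⟨by linarith [key a b], by linarith⟩
  rw [h1, penalty, ← Finset.sum_sub_distrib]
  refine (Finset.abs_sum_le_sum_abs _ _).trans ?_
  have h5 : ∀ i, abs (√|heatFlow G t (β * β) i| - √|groupAverage G (β * β) i|) ≤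
      Real.exp (-t * spectralGap G / 2) * √(norm2 (β * β)) := by
    intro i
    refine (hsub _ _).trans ?_
    rw [Real.exp_half, ← Real.sqrt_mul (Real.exp_pos _).le]
    exact Real.sqrt_le_sqrt ((abs_le_norm2 _ i).trans
      (norm2_heatFlow_sub_groupAverage_le G ht (β * β)))
  refine (Finset.sum_le_card_nsmul _ _ _ fun i _ => h5 i).trans ?_
  simp [mul_assoc]

end Graph

section Graph

variable {n p : ℕ} (G : SimpleGraph (Fin p))

/-! ### Triangle and Cauchy–Schwarz inequalities for group norms -/

lemma groupNorm_sub_comm (c : G.ConnectedComponent) (β β' : Fin p → ℝ) :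
    groupNorm G c (β - β') = groupNorm G c (β' - β) := subNorm_sub_comm _ _ _

lemma groupNorm_le_add_sub (c : G.ConnectedComponent) (β β' : Fin p → ℝ) :
    groupNorm G c β ≤ groupNorm G c β' + groupNorm G c (β - β') := by
  have := subNorm_add_le (groupSet G c) β' (β - β')
  rwa [add_sub_cancel] at this

lemma sum_sqrt_groupSize_mul_groupNorm_le [DecidableEq (Fin p)] (A : Finset G.ConnectedComponent)
    {s : ℕ} (hA : A.card ≤ s) (Δ : Fin p → ℝ) :
    ∑ c ∈ A, √(groupSize G c : ℝ) * groupNorm G c Δ ≤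
      √(s * maxGroupSize G : ℝ) * subNorm (A.biUnion (groupSet G)) Δ := by
  refine le_of_sq_le_sq ?_ (mul_nonneg (Real.sqrt_nonneg _) (subNorm_nonneg _ _))
  rw [mul_pow, Real.sq_sqrt (by positivity), ← sum_groupNorm_sq]
  refine (Finset.sum_mul_sq_le_sq_mul_sq A _ _).trans
    (mul_le_mul_of_nonneg_right ?_ (Finset.sum_nonneg fun c _ => sq_nonneg _))
  calc ∑ c ∈ A, √(groupSize G c : ℝ) ^ 2 ≤ ∑ _c ∈ A, (maxGroupSize G : ℝ) := by
        refine Finset.sum_le_sum fun c _ => ?_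
        rw [Real.sq_sqrt (Nat.cast_nonneg _)]
        exact_mod_cast groupSize_le_maxGroupSize G c
    _ = A.card * maxGroupSize G := by rw [Finset.sum_const, nsmul_eq_mul]
    _ ≤ s * maxGroupSize G := by gcongr

/-! ### The noise event -/

lemma norm_groupCols_mulVec_le (hn : 0 < n) (X : Matrix (Fin n) (Fin p) ℝ)
    (c : G.ConnectedComponent) (h : groupSet G c → ℝ) :
    ∑ i, (groupCols G X c).mulVec h i ^ 2 ≤ (n * gramOpNorm G X c) * ∑ j, h j ^ 2 := by
  have hn' : (n : ℝ) ≠ 0 := by positivity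
  set B := groupCols G X c with hB
  set Ψ := (1 / (n : ℝ)) • (B.transpose * B)
  have h1 : ∑ i, B.mulVec h i ^ 2 = n * (h ⬝ᵥ Ψ.mulVec h) := by
    rw [Matrix.smul_mulVec, dotProduct_smul, smul_eq_mul, ← mul_assoc, mul_one_div_cancel hn',
      one_mul, ← Matrix.mulVec_mulVec, Matrix.dotProduct_mulVec, Matrix.vecMul_transpose,
      dotProduct]
    exact Finset.sum_congr rfl fun i _ => by ring
  have h2 : norm2 (Ψ.mulVec h) ≤ gramOpNorm G X c * norm2 h := by
    have := (Matrix.toEuclideanCLM (𝕜 := ℝ) Ψ).le_opNorm (WithLp.toLp 2 h)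
    rwa [Matrix.toEuclideanCLM_toLp] at this
  have h3 := dotProduct_le_norm2_mul_norm2 h (Ψ.mulVec h)
  rw [h1, ← norm2_sq, mul_assoc]
  refine mul_le_mul_of_nonneg_left (h3.trans ?_) (Nat.cast_nonneg n)
  calc norm2 h * norm2 (Ψ.mulVec h) ≤ norm2 h * (gramOpNorm G X c * norm2 h) :=
        mul_le_mul_of_nonneg_left h2 (norm2_nonneg h)
    _ = _ := by ring

lemma sum_sq_transpose_groupCols_mulVec (X : Matrix (Fin n) (Fin p) ℝ) (c : G.ConnectedComponent)
    (x : Fin n → ℝ) :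
    ∑ j, (groupCols G X c).transpose.mulVec x j ^ 2 = groupNorm G c (X.transpose.mulVec x) ^ 2 := by
  rw [groupNorm_sq]
  exact Finset.sum_coe_sort (groupSet G c) (fun j => X.transpose.mulVec x j ^ 2)

lemma gramOpNorm_nonneg (X : Matrix (Fin n) (Fin p) ℝ) (c : G.ConnectedComponent) :
    0 ≤ gramOpNorm G X c := norm_nonneg _

lemma le_noiseLevel (X : Matrix (Fin n) (Fin p) ℝ) (η : ℝ) (c : G.ConnectedComponent) :
    √(gramOpNorm G X c) * (1 + √(4 * Real.log η⁻¹ / groupSize G c)) ≤ noiseLevel G X η :=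
  le_ciSup (f := fun c => √(gramOpNorm G X c) * (1 + √(4 * Real.log η⁻¹ / groupSize G c)))
    (Set.finite_range _).bddAbove c

/-- The Chernoff bound with `q = n ‖X_cᵀ X_c / n‖` and `r = √(4 log (1/η))`. The lower bound on
`lam` is exactly what places the threshold above `σ √q (√T_c + r)`. -/
lemma measure_groupNorm_transpose_mulVec_noise_gt_le (hn : 0 < n) (X : Matrix (Fin n) (Fin p) ℝ)
    {Ω : Type*} [MeasurableSpace Ω] (μ : Measure Ω) [IsProbabilityMeasure μ]
    (σ : NNReal) (noise : Fin n → Ω → ℝ)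
    (hlaw : ∀ i, HasLaw (noise i) (gaussianReal 0 (σ ^ 2)) μ) (hind : iIndepFun noise μ)
    {lam η : ℝ} (hη : 0 < η) (hη1 : η < 1)
    (hlam : 2 * (σ : ℝ) / √(n : ℝ) * noiseLevel G X η ≤ lam) (c : G.ConnectedComponent) :
    μ {ω | n * (√(groupSize G c : ℝ) * (lam / 2)) <
        groupNorm G c (X.transpose.mulVec fun i => noise i ω)} ≤ ENNReal.ofReal (2 * η) := by
  have hmap : μ.map (fun ω i => noise i ω) = Measure.pi fun _ => gaussianReal 0 (σ ^ 2) := by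
    rw [(iIndepFun_iff_map_fun_eq_pi_map fun i => (hlaw i).aemeasurable).1 hind]
    congr 1
    funext i
    exact (hlaw i).map_eq
  have hn' : 0 < (n : ℝ) := by exact_mod_cast hn
  have hT : 0 < (groupSize G c : ℝ) := by exact_mod_cast groupSize_pos G c
  have : Nonempty (groupSet G c) := (Finset.card_pos.1 (groupSize_pos G c)).to_subtype
  have hlog : 0 ≤ Real.log η⁻¹ := Real.log_nonneg ((one_le_inv₀ hη).2 hη1.le)
  set r := √(4 * Real.log η⁻¹) with hr
  have htail := pi_gaussianReal_sq_transpose_mulVec_gt_le (σ ^ 2) (groupCols G X c)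
    (mul_nonneg hn'.le (gramOpNorm_nonneg G X c)) (Real.sqrt_nonneg (4 * Real.log η⁻¹))
    (norm_groupCols_mulVec_le G hn X c)
  rw [Fintype.card_coe, ← groupSize, ← hr] at htail
  simp only [sum_sq_transpose_groupCols_mulVec] at htail
  -- The left side equals `η²`.
  have hexp : Real.exp (-r ^ 2 / 2) ≤ 2 * η := by
    have : -r ^ 2 / 2 = Real.log η + Real.log η := by
      rw [neg_div, hr, Real.sq_sqrt (by positivity), Real.log_inv]; ring
    rw [this, Real.exp_add, Real.exp_log hη]
    nlinarith
  have hthr : σ * √(n * gramOpNorm G X c) * (√(groupSize G c : ℝ) + r) ≤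
      n * (√(groupSize G c : ℝ) * (lam / 2)) := by
    have h1 := mul_le_mul_of_nonneg_left (le_noiseLevel G X η c)
      (show 0 ≤ 2 * (σ : ℝ) / √(n : ℝ) by positivity)
    have h2 := mul_le_mul_of_nonneg_left (h1.trans hlam)
      (show 0 ≤ n * √(groupSize G c : ℝ) / 2 by positivity)
    refine le_trans (le_of_eq ?_) (h2.trans (le_of_eq (by ring)))
    rw [Real.sqrt_div (by positivity), ← hr, Real.sqrt_mul hn'.le]
    have h3 := Real.sqrt_pos.2 hn'
    have h4 := Real.sqrt_pos.2 hT
    field_simp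
    rw [Real.sq_sqrt hn'.le]
    ring
  have hmeas : MeasurableSet {x : Fin n → ℝ | ((σ ^ 2 : NNReal) : ℝ) * (n * gramOpNorm G X c) *
      (√(groupSize G c : ℝ) + r) ^ 2 < groupNorm G c (X.transpose.mulVec x) ^ 2} := by
    refine measurableSet_lt measurable_const ?_
    simp only [groupNorm_sq, Matrix.mulVec, dotProduct]
    fun_prop
  have hae : AEMeasurable (fun ω i => noise i ω) μ :=
    aemeasurable_pi_lambda _ fun i => (hlaw i).aemeasurable
  rw [← hmap, Measure.map_apply_of_aemeasurable hae hmeas] at htail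
  refine le_trans (measure_mono fun ω hω => ?_) (htail.trans (ENNReal.ofReal_le_ofReal hexp))
  have h5 := pow_lt_pow_left₀ (hthr.trans_lt hω) (by positivity) two_ne_zero
  rw [mul_pow, mul_pow, Real.sq_sqrt (mul_nonneg hn'.le (gramOpNorm_nonneg G X c))] at h5
  exact_mod_cast h5

variable [DecidableRel G.Adj]

lemma exists_noise_event (hn : 0 < n) (X : Matrix (Fin n) (Fin p) ℝ)
    {Ω : Type*} [MeasurableSpace Ω] (μ : Measure Ω) [IsProbabilityMeasure μ]
    (σ : NNReal) (noise : Fin n → Ω → ℝ)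
    (hlaw : ∀ i, HasLaw (noise i) (gaussianReal 0 (σ ^ 2)) μ) (hind : iIndepFun noise μ)
    {lam η : ℝ} (hη : 0 < η) (hη1 : η < 1)
    (hlam : 2 * (σ : ℝ) / √(n : ℝ) * noiseLevel G X η ≤ lam) :
    ∃ E : Set Ω, MeasurableSet E ∧ 1 - 2 * numGroups G * η ≤ μ.real E ∧
      ∀ ω ∈ E, ∀ c, groupNorm G c (X.transpose.mulVec fun i => noise i ω) ≤
        n * (√(groupSize G c : ℝ) * (lam / 2)) := by
  set bad : Set Ω := ⋃ c : G.ConnectedComponent, {ω | n * (√(groupSize G c : ℝ) * (lam / 2)) <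
    groupNorm G c (X.transpose.mulVec fun i => noise i ω)} with hbad
  have h1 : μ bad ≤ ENNReal.ofReal (2 * numGroups G * η) := by
    refine (measure_iUnion_fintype_le μ _).trans ((Finset.sum_le_sum fun c _ =>
      measure_groupNorm_transpose_mulVec_noise_gt_le G hn X μ σ noise hlaw hind hη hη1 hlam c).trans
        ?_)
    rw [Finset.sum_const, Finset.card_univ, nsmul_eq_mul, ← numGroups, ← ENNReal.ofReal_natCast,
      ← ENNReal.ofReal_mul (Nat.cast_nonneg _)]
    exact ENNReal.ofReal_le_ofReal (le_of_eq (by ring))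
  -- The noise is only almost everywhere measurable, so `bad` is replaced by a measurable hull of
  -- the same measure.
  refine ⟨(toMeasurable μ bad)ᶜ, (measurableSet_toMeasurable _ _).compl, ?_, fun ω hω c => ?_⟩
  · rw [probReal_compl_eq_one_sub (measurableSet_toMeasurable _ _), measureReal_def,
      measure_toMeasurable]
    have := ENNReal.toReal_mono ENNReal.ofReal_ne_top h1
    rw [ENNReal.toReal_ofReal (by positivity)] at this
    linarith
  · by_contra hlt
    exact hω (subset_toMeasurable _ _ (Set.mem_iUnion.2 ⟨c, not_le.1 hlt⟩))

/-! ### Deterministic error bounds on the noise event -/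

lemma predError_nonneg (X : Matrix (Fin n) (Fin p) ℝ) (β β' : Fin p → ℝ) :
    0 ≤ predError X β β' := by
  rw [predError]; positivity

lemma groupPenalty_nonneg (β : Fin p → ℝ) : 0 ≤ groupPenalty G β :=
  Finset.sum_nonneg fun c _ => mul_nonneg (Real.sqrt_nonneg _) (groupNorm_nonneg G c β)

lemma groupPenalty_sub_le (β β' : Fin p → ℝ) :
    groupPenalty G (β - β') ≤ groupPenalty G β + groupPenalty G β' := by
  rw [groupPenalty, groupPenalty, groupPenalty, ← Finset.sum_add_distrib]
  refine Finset.sum_le_sum fun c _ => ?_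
  rw [← mul_add]
  refine mul_le_mul_of_nonneg_left ?_ (Real.sqrt_nonneg _)
  have h := subNorm_add_le (groupSet G c) β (-β')
  have h' : subNorm (groupSet G c) (-β') = subNorm (groupSet G c) β' :=
    norm_neg (WithLp.toLp 2 fun i : groupSet G c => β' i)
  rw [h', ← sub_eq_add_neg] at h
  exact h

/-- Duality: move `X` onto the noise and apply Cauchy–Schwarz in each group. -/
lemma dotProduct_mulVec_le_groupPenalty {X : Matrix (Fin n) (Fin p) ℝ} {e : Fin n → ℝ} {lam : ℝ}
    (he : ∀ c, groupNorm G c (X.transpose.mulVec e) ≤ n * (√(groupSize G c : ℝ) * (lam / 2)))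
    (Δ : Fin p → ℝ) : e ⬝ᵥ X.mulVec Δ ≤ n * (lam / 2 * groupPenalty G Δ) := by
  rw [Matrix.dotProduct_mulVec, ← Matrix.mulVec_transpose, dotProduct, ← sum_sum_groupSet G,
    groupPenalty, Finset.mul_sum, Finset.mul_sum]
  refine Finset.sum_le_sum fun c _ => ?_
  calc ∑ i ∈ groupSet G c, X.transpose.mulVec e i * Δ i
      ≤ groupNorm G c (X.transpose.mulVec e) * groupNorm G c Δ :=
        sum_mul_le_subNorm_mul_subNorm _ _ _
    _ ≤ n * (√(groupSize G c : ℝ) * (lam / 2)) * groupNorm G c Δ :=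
        mul_le_mul_of_nonneg_right (he c) (groupNorm_nonneg G c Δ)
    _ = _ := by ring

lemma predError_le_of_objective_le (hn : 0 < n) {X : Matrix (Fin n) (Fin p) ℝ} {e : Fin n → ℝ}
    {lam t : ℝ} {b βs : Fin p → ℝ}
    (he : ∀ c, groupNorm G c (X.transpose.mulVec e) ≤ n * (√(groupSize G c : ℝ) * (lam / 2)))
    (hb : objective G X (X.mulVec βs + e) t lam b ≤ objective G X (X.mulVec βs + e) t lam βs) :
    predError X b βs ≤
      lam * groupPenalty G (b - βs) + 2 * lam * (penalty G t βs - penalty G t b) := by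
  have hn' : 0 < (n : ℝ) := by exact_mod_cast hn
  have h1 : norm2 (X.mulVec βs + e - X.mulVec b) ^ 2 =
      norm2 e ^ 2 - 2 * (e ⬝ᵥ X.mulVec (b - βs)) + norm2 (X.mulVec (b - βs)) ^ 2 := by
    simp only [norm2_sq, dotProduct, Finset.mul_sum, ← Finset.sum_sub_distrib,
      ← Finset.sum_add_distrib, Matrix.mulVec_sub, Pi.sub_apply, Pi.add_apply]
    exact Finset.sum_congr rfl fun i _ => by ring
  rw [objective, objective, h1, add_sub_cancel_left] at hb
  have h2 := dotProduct_mulVec_le_groupPenalty G he (b - βs)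
  have h3 : norm2 (X.mulVec (b - βs)) ^ 2 = n * predError X b βs := by
    rw [predError]; field_simp
  rw [h3] at hb
  have h4 : 1 / (2 * (n : ℝ)) * (norm2 e ^ 2 - 2 * (e ⬝ᵥ X.mulVec (b - βs)) +
      n * predError X b βs) = 1 / (2 * n) * norm2 e ^ 2 - (e ⬝ᵥ X.mulVec (b - βs)) / n +
      predError X b βs / 2 := by
    field_simp
  rw [h4] at hb
  have h5 : (e ⬝ᵥ X.mulVec (b - βs)) / n ≤ lam / 2 * groupPenalty G (b - βs) := by
    rw [div_le_iff₀ hn']; linarith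
  linarith

/-- The basic inequality for the estimator in terms of the group lasso penalty. -/
lemma predError_le_of_isEstimator (hn : 0 < n) {X : Matrix (Fin n) (Fin p) ℝ} {e : Fin n → ℝ}
    {lam t ε ε₀ M : ℝ} {b βs : Fin p → ℝ} (ht : 0 ≤ t) (hlam : 0 < lam) (hε : 0 < ε) (hεε : ε ≤ ε₀)
    (he : ∀ c, groupNorm G c (X.transpose.mulVec e) ≤ n * (√(groupSize G c : ℝ) * (lam / 2)))
    (hM : (∀ β ∈ predBall X βs ε₀, √(norm2 (β * β)) ≤ M) ∨
      (p * Real.exp (-t * spectralGap G / 2) ≤ 1 / 4 ∧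
        √(maxGroupSize G : ℝ) * norm21 G βs ≤ M))
    (hb : IsEstimator G X (X.mulVec βs + e) t lam βs ε b) :
    0 ≤ M ∧ predError X b βs ≤ lam * groupPenalty G (b - βs) +
      2 * lam * (groupPenalty G βs - groupPenalty G b) +
      16 * (lam * M * (p * Real.exp (-t * spectralGap G / 2))) := by
  have hβs : ∀ ε' : ℝ, 0 < ε' → βs ∈ predBall X βs ε' := by
    intro ε' hε'
    simpa [predBall, norm2, sub_self, Matrix.mulVec_zero] using hε'.le
  have h1 := predError_le_of_objective_le G hn he (hb.2 (hβs ε hε))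
  set δ := p * Real.exp (-t * spectralGap G / 2) with hδ
  have hδ0 : 0 ≤ δ := by positivity
  have hs := abs_le.1 (abs_penalty_sub_groupPenalty_le G ht βs)
  have hh := abs_le.1 (abs_penalty_sub_groupPenalty_le G ht b)
  rw [← hδ] at hs hh
  have hD := predError_nonneg X b βs
  rcases hM with hM | ⟨hδ4, hM⟩
  · have hMs := hM βs (hβs ε₀ (hε.trans_le hεε))
    have hMb := hM b (le_trans (α := ℝ) hb.1 hεε)
    have hM0 := (Real.sqrt_nonneg _).trans hMs
    refine ⟨hM0, ?_⟩
    have h2 := mul_le_mul_of_nonneg_left hMs hδ0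
    have h3 := mul_le_mul_of_nonneg_left hMb hδ0
    -- Both approximation errors are at most `M δ`; the constant `8` is the one needed in the other
    -- case.
    have h4 : penalty G t βs - penalty G t b ≤
        groupPenalty G βs - groupPenalty G b + 8 * (M * δ) := by
      have : 0 ≤ M * δ := mul_nonneg hM0 hδ0
      linarith
    have := mul_le_mul_of_nonneg_left h4 hlam.le
    linarith
  · have hRM := (groupPenalty_le G βs).trans hM
    have hR0 := groupPenalty_nonneg G βs
    have hM0 := hR0.trans hRM
    refine ⟨hM0, ?_⟩
    have h2 := mul_le_mul_of_nonneg_left (((sqrt_norm2_mul_self_le_norm21 G βs).trans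
      (norm21_le_groupPenalty G βs)).trans hRM) hδ0
    have h3 := mul_le_mul_of_nonneg_left ((sqrt_norm2_mul_self_le_norm21 G b).trans
      (norm21_le_groupPenalty G b)) hδ0
    have hsub := groupPenalty_sub_le G b βs
    -- Here `M` bounds only `βs`, and `b` is controlled by self-bounding: `D ≥ 0` gives `(1 - 2δ)
    -- R(b) ≤ 3 R(βs) + 2δ M`, and `δ ≤ 1/4` then gives `7 M`. The two errors add up to `(1 + 7) M
    -- δ`.
    have hRb : groupPenalty G b ≤ 7 * M := by
      have h4 : 0 ≤ lam * (groupPenalty G (b - βs) + 2 * (penalty G t βs - penalty G t b)) := by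
        linarith
      have h5 := nonneg_of_mul_nonneg_right h4 hlam
      have h6 := mul_le_mul_of_nonneg_right hδ4 (groupPenalty_nonneg G b)
      have h7 := mul_le_mul_of_nonneg_right hδ4 hM0
      linarith
    have h8 := mul_le_mul_of_nonneg_left hRb hδ0
    have h4 : penalty G t βs - penalty G t b ≤
        groupPenalty G βs - groupPenalty G b + 8 * (M * δ) := by
      linarith
    have := mul_le_mul_of_nonneg_left h4 hlam.le
    linarith

lemma groupPenalty_eq_sum_add_sum_compl [DecidableEq G.ConnectedComponent]
    (A : Finset G.ConnectedComponent) (β : Fin p → ℝ) :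
    groupPenalty G β = ∑ c ∈ A, √(groupSize G c : ℝ) * groupNorm G c β +
      ∑ c ∈ Aᶜ, √(groupSize G c : ℝ) * groupNorm G c β :=
  (Finset.sum_add_sum_compl A _).symm

/-- Decomposability: outside `A` the vector `βs` vanishes, so `b` and `b - βs` have the same group
norms; inside `A` the triangle inequality suffices. -/
lemma groupPenalty_sub_groupPenalty_le [DecidableEq G.ConnectedComponent] (b βs : Fin p → ℝ)
    {A : Finset G.ConnectedComponent} (hA : ∀ c ∉ A, groupNorm G c βs = 0) :
    groupPenalty G βs - groupPenalty G b ≤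
      ∑ c ∈ A, √(groupSize G c : ℝ) * groupNorm G c (b - βs) -
        ∑ c ∈ Aᶜ, √(groupSize G c : ℝ) * groupNorm G c (b - βs) := by
  have h1 : ∑ c ∈ A, √(groupSize G c : ℝ) * groupNorm G c βs ≤
      ∑ c ∈ A, √(groupSize G c : ℝ) * groupNorm G c b +
        ∑ c ∈ A, √(groupSize G c : ℝ) * groupNorm G c (b - βs) := by
    rw [← Finset.sum_add_distrib]
    refine Finset.sum_le_sum fun c _ => ?_
    rw [← mul_add, groupNorm_sub_comm]
    exact mul_le_mul_of_nonneg_left (groupNorm_le_add_sub G c βs b) (Real.sqrt_nonneg _)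
  have h2 : ∑ c ∈ Aᶜ, √(groupSize G c : ℝ) * groupNorm G c (b - βs) ≤
      ∑ c ∈ Aᶜ, √(groupSize G c : ℝ) * groupNorm G c b := by
    refine Finset.sum_le_sum fun c hc => mul_le_mul_of_nonneg_left ?_ (Real.sqrt_nonneg _)
    have := groupNorm_le_add_sub G c (b - βs) b
    rw [sub_sub_cancel_left] at this
    have h0 : groupNorm G c (-βs) = 0 := by
      have := hA c (Finset.mem_compl.1 hc)
      rw [← this]
      exact norm_neg (WithLp.toLp 2 fun i : groupSet G c => βs i)
    rwa [h0, add_zero] at this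
  have h3 : ∑ c ∈ Aᶜ, √(groupSize G c : ℝ) * groupNorm G c βs = 0 :=
    Finset.sum_eq_zero fun c hc => by rw [hA c (Finset.mem_compl.1 hc), mul_zero]
  rw [groupPenalty_eq_sum_add_sum_compl G A βs, groupPenalty_eq_sum_add_sum_compl G A b, h3]
  linarith

/-- Error bounds under the restricted eigenvalue property, for any `Δ` with
`‖X Δ‖² / n + λ R_{Aᶜ}(Δ) ≤ 3 λ R_A(Δ) + 2 λ e`. -/
lemma errors_le_of_restrictedEigenvalue [DecidableEq G.ConnectedComponent] (hn : 0 < n)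
    {X : Matrix (Fin n) (Fin p) ℝ} {w κ lam e : ℝ} {s : ℕ} {b βs : Fin p → ℝ}
    {A : Finset G.ConnectedComponent} (hw : 0 < w) (hκ : 0 < κ) (hlam : 0 < lam) (he : 0 ≤ e)
    (hA : A.card ≤ s) (hRE : RestrictedEigenvalue G ((1 / √(n : ℝ)) • X) (3 + w) s κ)
    (h : predError X b βs + lam * ∑ c ∈ Aᶜ, √(groupSize G c : ℝ) * groupNorm G c (b - βs) ≤
      3 * lam * ∑ c ∈ A, √(groupSize G c : ℝ) * groupNorm G c (b - βs) + 2 * lam * e) :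
    predError X b βs ≤ (3 + w) ^ 2 * (s * lam ^ 2 * maxGroupSize G / κ ^ 2) +
        (6 / w + 2) * (lam * e) ∧
      groupPenalty G (b - βs) ≤ (4 + w) ^ 2 * (lam * s * maxGroupSize G / κ ^ 2) +
        (8 / w + 2) * e := by
  have hn' : 0 < (n : ℝ) := by exact_mod_cast hn
  have hD := predError_nonneg X b βs
  rw [groupPenalty_eq_sum_add_sum_compl G A]
  set Δ := b - βs with hΔ
  set D := predError X b βs with hDdef
  set U := ∑ c ∈ A, √(groupSize G c : ℝ) * groupNorm G c Δ with hU
  set V := ∑ c ∈ Aᶜ, √(groupSize G c : ℝ) * groupNorm G c Δ with hV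
  have hterm : ∀ c, 0 ≤ √(groupSize G c : ℝ) * groupNorm G c Δ := fun c =>
    mul_nonneg (Real.sqrt_nonneg _) (groupNorm_nonneg G c Δ)
  have hU0 : 0 ≤ U := Finset.sum_nonneg fun c _ => hterm c
  have hV0 : 0 ≤ V := Finset.sum_nonneg fun c _ => hterm c
  have hlV : 0 ≤ lam * V := mul_nonneg hlam.le hV0
  have hVle : V ≤ 3 * U + 2 * e := by
    have : lam * V ≤ lam * (3 * U + 2 * e) := by linarith
    exact le_of_mul_le_mul_left this hlam
  have hP1 : 0 ≤ (3 + w) ^ 2 * (s * lam ^ 2 * maxGroupSize G / κ ^ 2) := by positivity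
  have hP2 : 0 ≤ (4 + w) ^ 2 * (lam * s * maxGroupSize G / κ ^ 2) := by positivity
  -- Since `V ≤ 3 U + 2 e`, this case puts `Δ` in the cone of constant `3 + w`. Otherwise `U < 2 e /
  -- w`, and all bounds follow without the restricted eigenvalue property.
  by_cases hcase : 2 * e ≤ w * U
  · have hE1 : 0 ≤ (6 / w + 2) * (lam * e) := by positivity
    have hE2 : 0 ≤ (8 / w + 2) * e := by positivity
    have hVU : V ≤ (3 + w) * U := by linarith
    have hDU : D ≤ (3 + w) * lam * U := by
      have := mul_le_mul_of_nonneg_left hcase hlam.le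
      linarith
    set m : ℝ := s * maxGroupSize G with hm
    have hm0 : 0 ≤ m := by positivity
    have hUD : κ * U ≤ √m * √D := by
      by_cases hΔ0 : Δ = 0
      · have hU' : U = 0 := by
          refine Finset.sum_eq_zero fun c _ => ?_
          have : groupNorm G c Δ ^ 2 = 0 := by rw [groupNorm_sq, hΔ0]; simp
          rw [pow_eq_zero_iff two_ne_zero] at this
          rw [this, mul_zero]
        rw [hU', mul_zero]
        positivity
      · classical
        have h1 := hRE A Δ hA hΔ0 (by convert hVU)
        have hnum : norm2 (((1 / √(n : ℝ)) • X).mulVec Δ) = √D := by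
          rw [eq_comm, Real.sqrt_eq_iff_mul_self_eq hD (norm2_nonneg _), ← sq, norm2_sq,
            hDdef, predError, norm2_sq, Finset.mul_sum]
          refine Finset.sum_congr rfl fun i _ => ?_
          rw [Matrix.smul_mulVec, Pi.smul_apply, smul_eq_mul, mul_pow, div_pow, one_pow,
            Real.sq_sqrt hn'.le]
        rw [hnum] at h1
        have hsub := sum_sqrt_groupSize_mul_groupNorm_le G A hA Δ
        have hpos : 0 < subNorm (A.biUnion (groupSet G)) Δ := by
          refine (subNorm_nonneg _ _).lt_of_ne' fun h0 => ?_
          -- With a zero denominator the quotient is `0` by convention, so the property would force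
          -- `κ ≤ 0`.
          have h0' : κ ≤ 0 := by
            convert h1 using 1
            rw [eq_comm, div_eq_zero_iff]
            right
            convert h0
          linarith
        have h2 : κ * subNorm (A.biUnion (groupSet G)) Δ ≤ √D := by
          rw [← le_div_iff₀ hpos]
          convert h1
        calc κ * U ≤ κ * (√m * subNorm (A.biUnion (groupSet G)) Δ) :=
              mul_le_mul_of_nonneg_left hsub hκ.le
          _ = √m * (κ * subNorm (A.biUnion (groupSet G)) Δ) := by ring
          _ ≤ √m * √D := mul_le_mul_of_nonneg_left h2 (Real.sqrt_nonneg _)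
    -- `D` is bounded by `U` and `U` by `√D`; cancelling one factor `√D` closes the loop.
    have hsD : κ * √D ≤ (3 + w) * lam * √m := by
      rcases (Real.sqrt_nonneg D).eq_or_lt with h0 | h0
      · rw [← h0, mul_zero]; positivity
      · refine le_of_mul_le_mul_right ?_ h0
        calc κ * √D * √D = κ * D := by rw [mul_assoc, Real.mul_self_sqrt hD]
          _ ≤ κ * ((3 + w) * lam * U) := mul_le_mul_of_nonneg_left hDU hκ.le
          _ = (3 + w) * lam * (κ * U) := by ring
          _ ≤ (3 + w) * lam * (√m * √D) := mul_le_mul_of_nonneg_left hUD (by positivity)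
          _ = _ := by ring
    have hκ2 : 0 < κ ^ 2 := by positivity
    constructor
    · have h3 : D ≤ (3 + w) ^ 2 * (s * lam ^ 2 * maxGroupSize G / κ ^ 2) := by
        rw [← mul_div_assoc, le_div_iff₀ hκ2]
        have := pow_le_pow_left₀ (by positivity) hsD 2
        rw [mul_pow, mul_pow, Real.sq_sqrt hD, Real.sq_sqrt hm0, mul_pow] at this
        rw [hm] at this
        linarith
      linarith
    · have h4 : κ ^ 2 * U ≤ (3 + w) * (lam * m) := by
        calc κ ^ 2 * U = κ * (κ * U) := by ring
          _ ≤ κ * (√m * √D) := mul_le_mul_of_nonneg_left hUD hκ.le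
          _ = √m * (κ * √D) := by ring
          _ ≤ √m * ((3 + w) * lam * √m) := mul_le_mul_of_nonneg_left hsD (Real.sqrt_nonneg _)
          _ = (3 + w) * lam * (√m * √m) := by ring
          _ = _ := by rw [Real.mul_self_sqrt hm0]; ring
      have h5 : U + V ≤ (4 + w) ^ 2 * (lam * s * maxGroupSize G / κ ^ 2) := by
        rw [← mul_div_assoc, le_div_iff₀ hκ2]
        calc (U + V) * κ ^ 2 ≤ ((4 + w) * U) * κ ^ 2 :=
              mul_le_mul_of_nonneg_right (by linarith) hκ2.le
          _ = (4 + w) * (κ ^ 2 * U) := by ring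
          _ ≤ (4 + w) * ((3 + w) * (lam * m)) := mul_le_mul_of_nonneg_left h4 (by positivity)
          _ ≤ (4 + w) * ((4 + w) * (lam * m)) := by gcongr; norm_num
          _ = _ := by rw [hm]; ring
      linarith
  · have hUe : U ≤ 2 / w * e := by
      rw [div_mul_eq_mul_div, le_div_iff₀ hw]
      linarith
    have h6 := mul_le_mul_of_nonneg_left hUe hlam.le
    have e1 : (6 / w + 2) * (lam * e) = 3 * (lam * (2 / w * e)) + 2 * lam * e := by ring
    have e2 : (8 / w + 2) * e = 4 * (2 / w * e) + 2 * e := by ring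
    constructor
    · rw [e1]; linarith
    · rw [e2]; linarith

end Graph

end HeatFlow

/-! ### Assembly of the two rates and choice of constants -/

theorem theorem1 :
    ∃ K₀ : ℝ, 0 < K₀ ∧ ∃ K : ℝ → ℝ, (∀ w : ℝ, 0 < w → 0 < K w) ∧
      ∀ (n p : ℕ) (_ : 0 < n) (_ : 0 < p)
        (G : SimpleGraph (Fin p)) [DecidableRel G.Adj]
        (X : Matrix (Fin n) (Fin p) ℝ) (βs : Fin p → ℝ)
        {Ω : Type*} [MeasurableSpace Ω] (μ : Measure Ω) [IsProbabilityMeasure μ]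
        (σ : NNReal) (noise : Fin n → Ω → ℝ)
        (_ : ∀ i, HasLaw (noise i) (gaussianReal 0 (σ ^ 2)) μ) (_ : iIndepFun noise μ)
        (t lam η ε ε₀ M : ℝ)
        (_ : 0 ≤ t) (_ : 0 < lam) (_ : 0 < η) (_ : η < 1) (_ : 0 < ε) (_ : ε ≤ ε₀)
        (_ : 2 * (σ : ℝ) / √(n : ℝ) * HeatFlow.noiseLevel G X η ≤ lam)
        (_ : (∀ β ∈ HeatFlow.predBall X βs ε₀, √(HeatFlow.norm2 (β * β)) ≤ M) ∨
          (p * Real.exp (-t * HeatFlow.spectralGap G / 2) ≤ 1 / 4 ∧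
            √(HeatFlow.maxGroupSize G : ℝ) * HeatFlow.norm21 G βs ≤ M)),
      ∃ E : Set Ω, MeasurableSet E ∧ 1 - 2 * HeatFlow.numGroups G * η ≤ μ.real E ∧
        ∀ ω ∈ E, ∀ b : Fin p → ℝ,
          HeatFlow.IsEstimator G X (X.mulVec βs + fun i => noise i ω) t lam βs ε b →
          (8 * √(HeatFlow.maxGroupSize G : ℝ) * lam * HeatFlow.norm21 G βs ≤ ε →
            HeatFlow.predError X b βs ≤
              K₀ * (HeatFlow.norm21 G βs * lam * √(HeatFlow.maxGroupSize G : ℝ) +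
                lam * M * (p * Real.exp (-t * HeatFlow.spectralGap G / 2)))) ∧
          ∀ (w : ℝ) (s : ℕ) (κ : ℝ), 0 < w → 0 < κ → (HeatFlow.activeGroups G βs).card ≤ s →
            HeatFlow.RestrictedEigenvalue G ((1 / √(n : ℝ)) • X) (3 + w) s κ →
            (8 * √(HeatFlow.maxGroupSize G : ℝ) * lam * HeatFlow.norm21 G βs ≤ ε →
              HeatFlow.predError X b βs ≤
                K w * (s * lam ^ 2 * HeatFlow.maxGroupSize G / κ ^ 2 +
                  lam * M * (p * Real.exp (-t * HeatFlow.spectralGap G / 2)))) ∧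
            HeatFlow.norm21 G (b - βs) ≤
              K w * (lam * s * HeatFlow.maxGroupSize G / (κ ^ 2 * √(HeatFlow.minGroupSize G : ℝ)) +
                M * (p * Real.exp (-t * HeatFlow.spectralGap G / 2)) /
                  √(HeatFlow.minGroupSize G : ℝ)) := by
  classical
  -- `16` is the error factor of the basic inequality. In `K`, `(4 + w)²` covers both main terms,
  -- and `64 / w + 16` is `8 (8 / w + 2)`, the larger of the error factors once `e = 8 M δ`.
  refine ⟨16, by norm_num, fun w => (4 + w) ^ 2 + 64 / w + 16, fun w hw => by positivity, ?_⟩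
  intro n p hn hp G _ X βs Ω _ μ _ σ noise hlaw hind t lam η ε ε₀ M ht hlam hη hη1 hε hεε hnoise hM
  obtain ⟨E, hE, hprob, hgood⟩ :=
    HeatFlow.exists_noise_event G hn X μ σ noise hlaw hind hη hη1 hnoise
  refine ⟨E, hE, hprob, fun ω hω b hb => ?_⟩
  obtain ⟨hM0, hbasic⟩ :=
    HeatFlow.predError_le_of_isEstimator G hn ht hlam hε hεε (hgood ω hω) hM hb
  set δ := p * Real.exp (-t * HeatFlow.spectralGap G / 2)
  have hδ0 : 0 ≤ δ := by positivity
  have hMδ : 0 ≤ M * δ := mul_nonneg hM0 hδ0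
  have hlMδ : 0 ≤ lam * M * δ := mul_nonneg (mul_nonneg hlam.le hM0) hδ0
  refine ⟨fun _ => ?_, fun w s κ hw hκ hs hRE => ?_⟩
  · have h1 := mul_le_mul_of_nonneg_left (HeatFlow.groupPenalty_sub_le G b βs) hlam.le
    have h2 := mul_nonneg hlam.le (HeatFlow.groupPenalty_nonneg G b)
    have h3 := mul_le_mul_of_nonneg_left (HeatFlow.groupPenalty_le G βs) hlam.le
    have h4 := mul_nonneg hlam.le (HeatFlow.groupPenalty_nonneg G βs)
    linarith
  · set A := HeatFlow.activeGroups G βs with hA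
    have hA0 : ∀ c ∉ A, HeatFlow.groupNorm G c βs = 0 := by
      intro c hc
      by_contra h
      exact hc (by simpa [hA, HeatFlow.activeGroups] using h)
    have h1 := HeatFlow.groupPenalty_sub_groupPenalty_le G b βs hA0
    have h2 := HeatFlow.groupPenalty_eq_sum_add_sum_compl G A (b - βs)
    have h3 := mul_le_mul_of_nonneg_left h1 hlam.le
    rw [h2] at hbasic
    -- With `U`, `V` the parts of `R(b - βs)` on and off `A`, the basic inequality reads `D ≤ λ (U +
    -- V) + 2λ (U - V) + 16 λ M δ`, that is `D + λ V ≤ 3λ U + 2λ e`.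
    obtain ⟨h4, h5⟩ := HeatFlow.errors_le_of_restrictedEigenvalue G (b := b) (βs := βs) (A := A)
      (e := 8 * (M * δ)) hn hw hκ hlam (by positivity) hs hRE (by linarith)
    have hw' : 0 ≤ 64 / w := by positivity
    constructor
    · intro _
      refine h4.trans ?_
      have hQ : 0 ≤ s * lam ^ 2 * HeatFlow.maxGroupSize G / κ ^ 2 := by positivity
      have e1 : (6 / w + 2) * (lam * (8 * (M * δ))) = (64 / w * (3 / 4) + 16) * (lam * M * δ) := by
        ring
      rw [mul_add, e1]
      gcongr ?_ * _ + ?_ * _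
      · nlinarith
      · nlinarith
    · have : Nonempty G.ConnectedComponent := ⟨G.connectedComponentMk ⟨0, hp⟩⟩
      have hmin : 0 < √(HeatFlow.minGroupSize G : ℝ) :=
        Real.sqrt_pos.2 (by exact_mod_cast HeatFlow.minGroupSize_pos G)
      have h6 := (HeatFlow.sqrt_minGroupSize_mul_norm21_le G (b - βs)).trans h5
      have hQ : 0 ≤ lam * s * HeatFlow.maxGroupSize G / κ ^ 2 := by positivity
      rw [← div_div, ← add_div, ← mul_div_assoc, le_div_iff₀ hmin, mul_comm]
      refine h6.trans ?_
      have e1 : (8 / w + 2) * (8 * (M * δ)) = (64 / w + 16) * (M * δ) := by ring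
      rw [mul_add, e1]
      gcongr ?_ * _ + ?_ * _
      · linarith
      · nlinarith
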